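/- All graphs are finite, undirected and simple. For a graph $G$ and a real number $\alpha\in[0,1)$, let $A_\alpha(G)=\alpha D(G)+(1-\alpha)A(G)$, where $A(G)$ is the adjacency matrix of $G$ and $D(G)$ is the diagonal matrix of its vertex degrees, and let $\lambda_\alpha(G)$ be the largest eigenvalue of $A_\alpha(G)$. Write $K_m$ for the complete graph on $m$ vertices, $\cup$ for disjoint union, and $\vee$ for the join (the disjoint union together with all edges between the two graphs). A $P_{\geq 3}$-factor of $G$ is a spanning subgraph of $G$ every connected component of which is a path with at least $3$ vertices. Let $\alpha$ be a real number with $0\le\alpha<\frac23$, and let $G$ be a connected graph with $n\ge 25$ vertices such that $$\lambda_\alpha(G)\ \ge\ \lambda_\alpha\bigl(K_1\vee(K_{n-2}\cup K_1)\bigr).$$ If $G$ is not isomorphic to $K_1\vee(K_{n-2}\cup K_1)$, then $G$ has a $P_{\geq 3}$-factor. -/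

import Mathlib

namespace PathFactor

open SimpleGraph

universe u v

/-- The join `G ∨ H` of two vertex-disjoint graphs: the disjoint union of `G` and `H` together
with all edges between them. -/
def join {V : Type u} {W : Type v} (G : SimpleGraph V) (H : SimpleGraph W) :
    SimpleGraph (V ⊕ W) :=
  (G ⊕g H) ⊔ completeBipartiteGraph V W

/-- The graph `K₁ ∨ (K_{n-2} ∪ K₁)` (meaningful for `n ≥ 2`). -/
def extremalGraph (n : ℕ) : SimpleGraph (Fin 1 ⊕ (Fin (n - 2) ⊕ Fin 1)) :=
  join (completeGraph (Fin 1)) (completeGraph (Fin (n - 2)) ⊕g completeGraph (Fin 1))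

open Classical in
/-- The matrix `A_α(G) = α D(G) + (1 - α) A(G)`. -/
noncomputable def aAlphaMatrix {V : Type u} [Fintype V] (α : ℝ) (G : SimpleGraph V) :
    Matrix V V ℝ :=
  α • G.degMatrix ℝ + (1 - α) • G.adjMatrix ℝ

open Classical in
/-- The `A_α`-spectral radius `λ_α(G)`: the largest eigenvalue of the real symmetric matrix
`A_α(G)`. For a nonempty vertex set the spectrum is finite and nonempty, so the supremum is a
maximum. -/
noncomputable def lambdaAlpha {V : Type u} [Fintype V] (α : ℝ) (G : SimpleGraph V) : ℝ :=
  sSup (spectrum ℝ (aAlphaMatrix α G))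

/-- `H` is an `𝓗`-factor of `G`: a spanning subgraph of `G` each of whose connected components is
isomorphic to a member of the family `𝓗` of finite graphs. -/
def IsFactor {V : Type u} (𝓗 : Set (Σ k : ℕ, SimpleGraph (Fin k))) (G H : SimpleGraph V) : Prop :=
  H ≤ G ∧ ∀ C : H.ConnectedComponent, ∃ F ∈ 𝓗, Nonempty (C.toSimpleGraph ≃g F.2)

/-- The family `P_{≥ k} = {P_i | i ≥ k}`, where `P_i` is the path with `i` vertices. -/
def pathsGE (k : ℕ) : Set (Σ k : ℕ, SimpleGraph (Fin k)) :=
  {F | ∃ i : ℕ, k ≤ i ∧ F = ⟨i, pathGraph i⟩}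

/-- `G` has a `P_{≥ k}`-factor. -/
def HasPathFactorGE {V : Type u} (k : ℕ) (G : SimpleGraph V) : Prop :=
  ∃ H : SimpleGraph V, IsFactor (pathsGE k) G H

end PathFactor

/-! ### Hamiltonian paths as path factors -/

namespace PathFactor

open SimpleGraph

universe u

/-! The hypothesis is strong enough to force a Hamiltonian path, which is itself the factor. The
extremal graph contains `K_{n-1}`, so its `λ_α`, and hence that of `G`, is at least `n - 2`
(`le_lambdaAlpha_extremalGraph`). A degree-weighted AM-GM estimate bounds `λ_α` by the maximum of
`(2/3) d(v) + (1/3) m(v)`, so `λ_α ≥ n - 2` forces degree sum at least `(n - 1)(n - 3)`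
(`sum_degrees_of_le_lambdaAlpha`).

Such a dense connected graph is traceable (`traceable_of_sum_degrees`). Otherwise enlarge it to an
edge-maximal non-traceable graph. By Ore's rerouting argument non-adjacent vertices there have small
degree sum, so each non-edge has an endpoint of large codegree. There are too few non-edges for this
unless all of them share one vertex; a clique plus one attached vertex is traceable, a
contradiction. -/

/-- `G` is traceable: its vertices can be listed, without repetition, so that consecutive ones are
adjacent. In other words, `G` has a Hamiltonian path. -/
def Traceable {V : Type u} (G : SimpleGraph V) : Prop :=
  ∃ l : List V, l.Nodup ∧ (∀ v, v ∈ l) ∧ l.IsChain G.Adj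

/-- A Hamiltonian path on at least `k` vertices is a `P_{≥ k}`-factor. -/
theorem Traceable.hasPathFactorGE {V : Type u} [Fintype V] {G : SimpleGraph V} (hG : Traceable G)
    {k : ℕ} (hk : k ≤ Fintype.card V) : HasPathFactorGE k G := by
  classical
  obtain ⟨l, hnd, hmem, hch⟩ := hG
  let e : Fin l.length ≃ V := hnd.getEquivOfForallMemList l hmem
  have hlen : l.length = Fintype.card V := by simpa using Fintype.card_congr e
  have he : ∀ i : Fin l.length, e i = l[i] := fun i => rfl
  let H : SimpleGraph V := (pathGraph l.length).map e.toEmbedding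
  have iso : pathGraph l.length ≃g H := Iso.map e _
  have hH : H.Preconnected := iso.preconnected_iff.1 (pathGraph_preconnected _)
  refine ⟨H, ?_, fun C => ⟨⟨l.length, pathGraph l.length⟩, ⟨_, by omega, rfl⟩, ?_⟩⟩
  · rw [SimpleGraph.map_le_iff_le_comap]
    intro i j hij
    rw [List.isChain_iff_getElem] at hch
    rw [SimpleGraph.comap_adj]
    change G.Adj (e i) (e j)
    rw [he, he]
    rcases pathGraph_adj.1 hij with h | h
    · have := hch i (by omega)
      simpa [h] using this
    · have := (hch j (by omega)).symm
      simpa [h] using this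
  · have hs := hH.subsingleton_connectedComponent
    have hC : C.supp = Set.univ := by
      ext v
      simp [ConnectedComponent.mem_supp_iff, eq_iff_true_of_subsingleton]
    have h1 : C.toSimpleGraph ≃g H := by
      unfold ConnectedComponent.toSimpleGraph
      change H.induce C.supp ≃g H
      rw [hC]
      exact induceUnivIso H
    exact ⟨h1.trans iso.symm⟩

/-! ### Ore-type rerouting -/

/-- If no two consecutive entries `a, b` of a list satisfy `p a` and `q b`, and `p` fails at the
last entry, then `p` and the restriction of `q` to the tail hold at most `length - 1` times. -/
theorem countP_add_countP_tail_le {α : Type u} (p q : α → Bool) :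
    ∀ (a : α) (l : List α), (a :: l).IsChain (fun b c => ¬ (p b ∧ q c)) →
      ¬ p ((a :: l).getLast (by simp)) →
      (a :: l).countP p + l.countP q ≤ l.length
  | a, [], _, h => by simpa using h
  | a, b :: l, hc, h => by
    rw [List.isChain_cons_cons] at hc
    have ih := countP_add_countP_tail_le p q b l hc.2 (by simpa using h)
    have h1 := hc.1
    rw [List.countP_cons (a := a), List.countP_cons (p := q) (a := b), List.length_cons]
    split_ifs with h2 h3 h3
    · exact absurd ⟨h2, h3⟩ h1
    all_goals omega

/-- The variant for a list where `q` moreover fails at the first entry. -/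
theorem countP_add_countP_lt_length {α : Type u} (p q : α → Bool) (l : List α) (hl : l ≠ [])
    (hc : l.IsChain (fun b c => ¬ (p b ∧ q c))) (hp : ¬ p (l.getLast hl)) (hq : ¬ q (l.head hl)) :
    l.countP p + l.countP q < l.length := by
  cases l with
  | nil => exact absurd rfl hl
  | cons a l =>
    have := countP_add_countP_tail_le p q a l hc hp
    rw [List.countP_cons (p := q) (a := a), if_neg (by simpa using hq), List.length_cons]
    omega

open Classical in
theorem degree_eq_countP {V : Type u} [Fintype V] (G : SimpleGraph V) (v : V) {l : List V}
    (hnd : l.Nodup) (hmem : ∀ v, v ∈ l) : G.degree v = l.countP (fun w => G.Adj v w) := by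
  rw [List.countP_eq_length_filter, ← List.toFinset_card_of_nodup (hnd.filter _),
    ← card_neighborFinset_eq_degree]
  congr 1
  ext w
  simp [hmem]

open Classical in
/-- A Hamiltonian path of `G + xy` through the edge `xy`, listed as `P ++ Q` with `P` ending at `x`
and `Q` starting at `y`, can be rerouted within `G` if `d(x) + d(y) ≥ |V| - 1`. -/
theorem degree_add_degree_of_not_traceable {V : Type u} [Fintype V] {G : SimpleGraph V}
    (hG : ¬ Traceable G) {x y : V} {P Q : List V} (hnd : ((P ++ [x]) ++ y :: Q).Nodup)
    (hmem : ∀ v, v ∈ (P ++ [x]) ++ y :: Q)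
    (hP : (P ++ [x]).IsChain G.Adj) (hQ : (y :: Q).IsChain G.Adj) :
    G.degree x + G.degree y + 2 ≤ Fintype.card V := by
  have hcard : Fintype.card V = ((P ++ [x]) ++ y :: Q).length := by
    rw [← List.toFinset_card_of_nodup hnd, ← Finset.card_univ]
    congr 1
    ext v
    exact ⟨fun _ => List.mem_toFinset.2 (hmem v), fun _ => Finset.mem_univ v⟩
  have key : ∀ l : List V, l.Perm ((P ++ [x]) ++ y :: Q) → ¬ l.IsChain G.Adj := fun l hl hc =>
    hG ⟨l, hl.nodup_iff.2 hnd, fun v => hl.mem_iff.2 (hmem v), hc⟩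
  have hsymm : (fun a b => G.Adj b a) = G.Adj := by
    ext a b
    exact G.adj_comm b a
  have hrev : ∀ {l : List V}, l.IsChain G.Adj → l.reverse.IsChain G.Adj := fun {l} h => by
    rwa [List.isChain_reverse, hsymm]
  -- For consecutive `a, b` before the edge `xy`, `x ~ a` and `y ~ b` would give the path `… a, x …
  -- b, y …`, with the segment from `b` to `x` reversed. If `y` is adjacent to the first vertex,
  -- reversing the whole first half works.
  have h1 := countP_add_countP_lt_length (fun w => decide (G.Adj x w)) (fun w => decide (G.Adj y w))
    (P ++ [x]) (by simp)
    (by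
      rw [List.isChain_iff_forall_rel_of_append_cons_cons]
      rintro a b l₁ l₂ h ⟨hxa, hyb⟩
      rw [h] at hP
      have hP1 : (l₁ ++ [a]).IsChain G.Adj := by
        apply List.IsChain.left_of_append (l₂ := b :: l₂); simpa using hP
      have hP2 : (b :: l₂).IsChain G.Adj := by
        apply List.IsChain.right_of_append (l₁ := l₁ ++ [a]); simpa using hP
      have hlast : (b :: l₂).getLast? = some x := by
        have : (P ++ [x]).getLast? = some x := by simp
        rw [h] at this
        simpa using this
      refine key ((l₁ ++ [a]) ++ (b :: l₂).reverse ++ (y :: Q)) ?_ ?_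
      · rw [h]
        refine List.Perm.append_right _ ?_
        have := (List.reverse_perm (b :: l₂)).append_left (l₁ ++ [a])
        simpa using this
      · refine List.IsChain.append (List.IsChain.append hP1 (hrev hP2) ?_) hQ ?_
        · intro u hu v hv
          rw [List.head?_reverse, hlast] at hv
          simp at hu hv hxa
          subst hu hv
          exact hxa.symm
        · intro u hu v hv
          rw [List.getLast?_append, List.getLast?_reverse] at hu
          simp at hu hv hyb
          subst hu hv
          exact hyb.symm)
    (by simp)
    (by
      intro hy
      refine key ((P ++ [x]).reverse ++ y :: Q) ((List.reverse_perm _).append_right _)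
        (List.IsChain.append (hrev hP) hQ ?_)
      intro u hu v hv
      rw [List.getLast?_reverse, List.head?_eq_some_head (by simp)] at hu
      simp only [Option.mem_def, Option.some.injEq] at hu
      simp only [List.head?_cons, Option.mem_def, Option.some.injEq] at hv
      subst hu hv
      exact (of_decide_eq_true hy).symm)
  -- Symmetrically, after the edge `xy` the reroute is `… x, a … y, b …`. Each half thus loses at
  -- least one from its length, which gives the `2` in the bound.
  have h2 := countP_add_countP_lt_length (fun w => decide (G.Adj x w)) (fun w => decide (G.Adj y w))
    (y :: Q) (by simp)
    (by
      rw [List.isChain_iff_forall_rel_of_append_cons_cons]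
      rintro a b l₁ l₂ h ⟨hxa, hyb⟩
      rw [h] at hQ
      have hQ1 : (l₁ ++ [a]).IsChain G.Adj := by
        apply List.IsChain.left_of_append (l₂ := b :: l₂); simpa using hQ
      have hQ2 : (b :: l₂).IsChain G.Adj := by
        apply List.IsChain.right_of_append (l₁ := l₁ ++ [a]); simpa using hQ
      have hhead : (l₁ ++ [a]).head? = some y := by
        have : (y :: Q).head? = some y := by simp
        rw [h] at this
        cases l₁ <;> simpa using this
      refine key ((P ++ [x]) ++ ((l₁ ++ [a]).reverse ++ (b :: l₂))) ?_ ?_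
      · rw [h]
        refine List.Perm.append_left _ ?_
        have := (List.reverse_perm (l₁ ++ [a])).append_right (b :: l₂)
        simpa using this
      · refine List.IsChain.append hP (List.IsChain.append (hrev hQ1) hQ2 ?_) ?_
        · intro u hu v hv
          rw [List.getLast?_reverse, hhead] at hu
          simp at hu hv hyb
          subst hu hv
          exact hyb
        · intro u hu v hv
          simp at hu hv hxa
          subst hu hv
          exact hxa)
    (by
      intro hx
      refine key ((P ++ [x]) ++ (y :: Q).reverse) ((List.reverse_perm _).append_left _)
        (List.IsChain.append hP (hrev hQ) ?_)
      intro u hu v hv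
      rw [List.head?_reverse, List.getLast?_eq_some_getLast (by simp)] at hv
      simp only [Option.mem_def, Option.some.injEq] at hv
      simp only [List.getLast?_append, List.getLast?_singleton, Option.some_or, Option.mem_def,
        Option.some.injEq] at hu
      subst hu hv
      exact of_decide_eq_true hx)
    (by simp)
  rw [degree_eq_countP G x hnd hmem, degree_eq_countP G y hnd hmem, hcard, List.countP_append,
    List.countP_append (l₁ := P ++ [x]), List.length_append]
  omega

open Classical in
/-- Ore-type condition: in an edge-maximal non-traceable graph, two non-adjacent vertices have
degree sum at most `|V| - 2`. -/
theorem degree_add_degree_of_maximal {V : Type u} [Fintype V] {G : SimpleGraph V}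
    (hG : Maximal (fun H : SimpleGraph V => ¬ Traceable H) G) {x y : V} (hxy : x ≠ y)
    (hadj : ¬ G.Adj x y) : G.degree x + G.degree y + 2 ≤ Fintype.card V := by
  have htr : Traceable (G ⊔ edge x y) := by
    by_contra h
    exact hadj (hG.le_of_ge h le_sup_left (by simp [edge_adj, hxy]))
  obtain ⟨l, hnd, hmem, hch⟩ := htr
  have hnot : ¬ l.IsChain G.Adj := fun h => hG.prop ⟨l, hnd, hmem, h⟩
  rw [List.isChain_iff_forall_rel_of_append_cons_cons] at hnot
  push Not at hnot
  obtain ⟨a, b, P, Q, rfl, hab⟩ := hnot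
  have heq : P ++ a :: b :: Q = (P ++ [a]) ++ b :: Q := by simp
  rw [heq] at hnd hmem hch
  -- The step where the path leaves `G` must be the added edge. Each half misses one endpoint of
  -- that edge, so it is a path in `G`.
  have hpair : (a = x ∧ b = y) ∨ (a = y ∧ b = x) := by
    have h1 : (G ⊔ edge x y).Adj a b := by
      have := hch.rel_getLast_head_of_append (by simp) (by simp)
      simpa using this
    simp only [sup_adj, edge_adj] at h1
    tauto
  have hdisj := (List.nodup_append.1 hnd).2.2
  have hP : (P ++ [a]).IsChain G.Adj := by
    refine hch.left_of_append.imp_of_mem_imp fun c d hc hd hcd => ?_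
    have h1 := hdisj c hc b (by simp)
    have h2 := hdisj d hd b (by simp)
    simp only [sup_adj, edge_adj] at hcd
    grind
  have hQ : (b :: Q).IsChain G.Adj := by
    refine hch.right_of_append.imp_of_mem_imp fun c d hc hd hcd => ?_
    have h1 := hdisj a (by simp) c hc
    have h2 := hdisj a (by simp) d hd
    simp only [sup_adj, edge_adj] at hcd
    grind
  have := degree_add_degree_of_not_traceable hG.prop hnd hmem hP hQ
  rcases hpair with ⟨rfl, rfl⟩ | ⟨rfl, rfl⟩ <;> omega

/-- If all vertices other than `u` are pairwise adjacent and `u` has a neighbour, then the graph is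
traceable. -/
theorem traceable_of_isClique_compl_singleton {V : Type u} [Fintype V] {G : SimpleGraph V} {u c : V}
    (huc : G.Adj u c) (h : ∀ x y, x ≠ u → y ≠ u → x ≠ y → G.Adj x y) : Traceable G := by
  classical
  refine ⟨u :: c :: ((Finset.univ.erase u).erase c).toList, ?_, fun v => ?_, ?_⟩
  · simp [huc.ne, Finset.nodup_toList]
  · simp only [List.mem_cons, Finset.mem_toList, Finset.mem_erase, Finset.mem_univ, and_true]
    tauto
  · refine List.IsChain.cons_cons huc (List.Pairwise.isChain ?_)
    have hnd : (c :: ((Finset.univ.erase u).erase c).toList).Nodup := by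
      simp [Finset.nodup_toList]
    refine hnd.imp_of_mem fun {a b} ha hb hab => h a b ?_ ?_ hab
    · rintro rfl
      simp [huc.ne] at ha
    · rintro rfl
      simp [huc.ne] at hb

/-! ### Traceability of graphs with few non-edges -/

open Classical in
/-- A connected graph on `n ≥ 10` vertices with at most `3(n - 1)/2` non-edges is traceable. -/
theorem traceable_of_sum_degrees {V : Type u} [Fintype V] {G : SimpleGraph V} (hG : G.Connected)
    (hn : 10 ≤ Fintype.card V)
    (hdeg : (Fintype.card V - 1) * (Fintype.card V - 3) ≤ ∑ v, G.degree v) : Traceable G := by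
  by_contra hnt
  obtain ⟨H, hGH, hmax⟩ := Finite.exists_le_maximal (p := fun H : SimpleGraph V => ¬ Traceable H) hnt
  have hHc : H.Connected := hG.mono hGH
  obtain ⟨n, hnV⟩ : ∃ n, n = Fintype.card V := ⟨_, rfl⟩
  rw [← hnV] at hn hdeg
  have hsum : ∑ v, G.degree v ≤ ∑ v, H.degree v :=
    Finset.sum_le_sum fun v _ => degree_le_of_le hGH
  -- `c` is the codegree `n - 1 - d`. Connectedness gives `c ≤ n - 2`, the degree sum gives `∑ c ≤
  -- n(n - 1) - (n - 1)(n - 3) = 3(n - 1)`, and the Ore bound becomes `c x + c y ≥ n` on non-edges.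
  obtain ⟨c, hc⟩ : ∃ c : V → ℤ, ∀ v, c v = Hᶜ.degree v := ⟨_, fun _ => rfl⟩
  have hcd : ∀ v, c v + H.degree v = n - 1 := fun v => by
    have h1 := H.degree_compl v
    have h2 := H.degree_lt_card_verts v
    rw [hc]
    omega
  have hc0 : ∀ v, 0 ≤ c v := fun v => by rw [hc]; positivity
  have hnontriv : Nontrivial V := Fintype.one_lt_card_iff_nontrivial.1 (by omega)
  have hc2 : ∀ v, c v ≤ n - 2 := fun v => by
    have h1 := hHc.preconnected.degree_pos_of_nontrivial v
    have h2 := hcd v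
    omega
  have hcsum : ∑ v, c v ≤ 3 * (n - 1) := by
    have h1 : ∑ v, (c v + H.degree v) = n * ((n : ℤ) - 1) := by
      rw [Finset.sum_congr rfl fun v _ => hcd v, Finset.sum_const, Finset.card_univ, ← hnV]
      simp
    rw [Finset.sum_add_distrib] at h1
    have h2 : (((n - 1) * (n - 3) : ℕ) : ℤ) ≤ ∑ v, (H.degree v : ℤ) := by
      exact_mod_cast hdeg.trans hsum
    push_cast [show 1 ≤ n by omega, show 3 ≤ n by omega] at h2
    nlinarith
  have hpair : ∀ x y, Hᶜ.Adj x y → (n : ℤ) ≤ c x + c y := fun x y hxy => by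
    have h1 := degree_add_degree_of_maximal hmax hxy.1 hxy.2
    have h2 := hcd x
    have h3 := hcd y
    omega
  have hn' : (10 : ℤ) ≤ n := by exact_mod_cast hn
  have hnbr : ∀ (x : V) (s : Finset V), s ⊆ Hᶜ.neighborFinset x → s.card * (n - c x) ≤ ∑ v ∈ s, c v := by
    intro x s hs
    rw [← nsmul_eq_mul]
    refine Finset.card_nsmul_le_sum _ _ _ fun w hw => ?_
    have := hpair x w (by simpa using hs hw)
    linarith
  have hcardnbr : ∀ x, ((Hᶜ.neighborFinset x).card : ℤ) = c x := fun x => by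
    rw [hc, card_neighborFinset_eq_degree]
  -- A vertex missing at least half of the possible edges is a pendant vertex.
  have hpend : ∀ u, (n : ℤ) ≤ 2 * c u → c u = n - 2 := by
    intro u hu
    have h1 := hnbr u _ subset_rfl
    rw [hcardnbr] at h1
    have h2 : c u + ∑ v ∈ Hᶜ.neighborFinset u, c v ≤ ∑ v, c v := by
      rw [← Finset.sum_insert (by simp)]
      exact Finset.sum_le_sum_of_subset_of_nonneg (Finset.subset_univ _) fun v _ _ => hc0 v
    by_contra hne
    have h3 : c u ≤ n - 3 := by have := hc2 u; omega
    -- The total codegree is at least `c u * (n + 1 - c u)`, which is concave in `c u` and equals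
    -- `4(n - 3)` at both `4` and `n - 3`. This exceeds `3(n - 1)` exactly when `n > 9`.
    nlinarith [mul_nonneg (show 0 ≤ c u - 4 by linarith) (show 0 ≤ n - 3 - c u by linarith)]
  have hpair' : ∀ x y, Hᶜ.Adj x y → c x = n - 2 ∨ c y = n - 2 := fun x y hxy => by
    rcases le_total (c x) (c y) with h | h
    · exact Or.inr (hpend y (by linarith [hpair x y hxy]))
    · exact Or.inl (hpend x (by linarith [hpair x y hxy]))
  -- There is at most one pendant vertex.
  have huniq : ∀ u x, c u = n - 2 → c x = n - 2 → u = x := by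
    intro u x hu hx
    by_contra hux
    have h1 := hnbr x ((Hᶜ.neighborFinset x).erase u) (Finset.erase_subset _ _)
    have h2 : (n : ℤ) - 3 ≤ ((Hᶜ.neighborFinset x).erase u).card := by
      have h3 := Finset.pred_card_le_card_erase (s := Hᶜ.neighborFinset x) (a := u)
      have h4 := hcardnbr x
      omega
    have h3 : c u + (c x + ∑ v ∈ (Hᶜ.neighborFinset x).erase u, c v) ≤ ∑ v, c v := by
      rw [← Finset.sum_insert (by simp), ← Finset.sum_insert (by simp [hux])]
      exact Finset.sum_le_sum_of_subset_of_nonneg (Finset.subset_univ _) fun v _ _ => hc0 v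
    rw [hx] at h1 h3
    -- Two pendant vertices contribute `2(n - 2)`, and at least `n - 3` others have codegree at
    -- least `2`; the total `4n - 10` is more than `3(n - 1)`.
    nlinarith
  -- Every non-edge contains the pendant vertex; if there is none, the graph is complete and any `u`
  -- will do.
  obtain ⟨u, hu⟩ : ∃ u, ∀ x y, x ≠ u → y ≠ u → x ≠ y → H.Adj x y := by
    by_cases hex : ∃ u, c u = n - 2
    · obtain ⟨u, hu⟩ := hex
      refine ⟨u, fun x y hx hy hxy => ?_⟩
      by_contra hadj
      rcases hpair' x y ⟨hxy, hadj⟩ with h | h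
      · exact hx (huniq x u h hu)
      · exact hy (huniq y u h hu)
    · obtain ⟨u⟩ := hHc.nonempty
      refine ⟨u, fun x y _ _ hxy => ?_⟩
      by_contra hadj
      exact hex ((hpair' x y ⟨hxy, hadj⟩).elim (⟨_, ·⟩) (⟨_, ·⟩))
  obtain ⟨w, hw⟩ := (H.degree_pos_iff_exists_adj u).1
    (hHc.preconnected.degree_pos_of_nontrivial u)
  exact hmax.prop (traceable_of_isClique_compl_singleton hw hu)

end PathFactor

/-! ### Rayleigh quotients and the quadratic form of `A_α` -/

namespace PathFactor

open SimpleGraph Matrix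

universe u

section Spectrum

variable {V : Type u} [Fintype V] [DecidableEq V]

/-- The quadratic form of a real symmetric matrix is bounded by the largest eigenvalue. -/
theorem dotProduct_mulVec_le_sSup_spectrum {M : Matrix V V ℝ} (hM : M.IsHermitian) (x : V → ℝ) :
    x ⬝ᵥ M *ᵥ x ≤ sSup (spectrum ℝ M) * (x ⬝ᵥ x) := by
  have hbdd : BddAbove (spectrum ℝ M) := M.finite_real_spectrum.bddAbove
  have hpsd : (algebraMap ℝ (Matrix V V ℝ) (sSup (spectrum ℝ M)) - M).PosSemidef := by
    rw [posSemidef_iff_isHermitian_and_spectrum_nonneg]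
    refine ⟨?_, ?_⟩
    · refine IsHermitian.sub ?_ hM
      rw [Algebra.algebraMap_eq_smul_one]
      simp [IsHermitian]
    · rw [← spectrum.singleton_sub_eq]
      rintro _ ⟨a, rfl, b, hb, rfl⟩
      simpa using le_csSup hbdd hb
  have := hpsd.dotProduct_mulVec_nonneg x
  rw [Algebra.algebraMap_eq_smul_one, sub_mulVec, dotProduct_sub, smul_mulVec, one_mulVec,
    dotProduct_smul, star_trivial, smul_eq_mul] at this
  linarith

/-- The largest eigenvalue of a real symmetric matrix is attained by its quadratic form. -/
theorem exists_dotProduct_mulVec_eq_sSup_spectrum [Nonempty V] {M : Matrix V V ℝ}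
    (hM : M.IsHermitian) :
    ∃ x : V → ℝ, x ≠ 0 ∧ x ⬝ᵥ M *ᵥ x = sSup (spectrum ℝ M) * (x ⬝ᵥ x) := by
  have hmem : sSup (spectrum ℝ M) ∈ spectrum ℝ M := by
    refine Set.Nonempty.csSup_mem ?_ M.finite_real_spectrum
    rw [hM.spectrum_real_eq_range_eigenvalues]
    exact Set.range_nonempty _
  rw [hM.spectrum_real_eq_range_eigenvalues] at hmem
  obtain ⟨j, hj⟩ := hmem
  refine ⟨hM.eigenvectorBasis j, fun h => ?_, ?_⟩
  · refine hM.eigenvectorBasis.toBasis.ne_zero j ?_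
    ext i
    simpa using congrFun h i
  · rw [hM.mulVec_eigenvectorBasis, dotProduct_smul, smul_eq_mul, hj,
      hM.spectrum_real_eq_range_eigenvalues]

end Spectrum

theorem isHermitian_aAlphaMatrix {V : Type u} [Fintype V] (α : ℝ) (G : SimpleGraph V) :
    (aAlphaMatrix α G).IsHermitian := by
  classical
  unfold aAlphaMatrix
  ext i j
  by_cases h : i = j
  · simp [h]
  · simp [degMatrix, h, Ne.symm h, G.adj_comm]

open Classical in
/-- The quadratic form of `A_α(G)`, written as a sum over ordered pairs. -/
theorem dotProduct_aAlphaMatrix_mulVec {V : Type u} [Fintype V] (α : ℝ) (G : SimpleGraph V)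
    (x : V → ℝ) : x ⬝ᵥ aAlphaMatrix α G *ᵥ x =
      ∑ v, ∑ w, if G.Adj v w then α * x v ^ 2 + (1 - α) * (x v * x w) else 0 := by
  simp only [dotProduct]
  refine Finset.sum_congr rfl fun v _ => ?_
  have h1 : (aAlphaMatrix α G *ᵥ x) v =
      α * (G.degree v * x v) + (1 - α) * ∑ w, if G.Adj v w then x w else 0 := by
    simp [aAlphaMatrix, add_mulVec, smul_mulVec, degMatrix, mulVec_diagonal, Finset.sum_ite,
      neighborFinset_eq_filter]
  rw [h1, ← card_neighborFinset_eq_degree, neighborFinset_eq_filter, Finset.card_filter]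
  push_cast
  rw [Finset.sum_mul, Finset.mul_sum, Finset.mul_sum, ← Finset.sum_add_distrib, Finset.mul_sum]
  refine Finset.sum_congr rfl fun w _ => ?_
  split_ifs <;> ring

/-! ### Degree bounds for `λ_α` -/

open Classical in
/-- If every vertex `v` satisfies `(2/3) d(v) + (1/3) m(v) < c`, with `m(v)` the average degree of
the neighbours of `v`, then `λ_α(G) < c` for all `α ≤ 2/3`. -/
theorem lambdaAlpha_lt_of_forall {V : Type u} [Fintype V] [Nonempty V] {α c : ℝ} (hα : α ≤ 2 / 3)
    (G : SimpleGraph V) (hpos : ∀ v, 0 < G.degree v)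
    (h : ∀ v, 2 * (G.degree v : ℝ) ^ 2 + ∑ w ∈ G.neighborFinset v, (G.degree w : ℝ) <
      3 * c * G.degree v) :
    lambdaAlpha α G < c := by
  obtain ⟨x, hx0, hx⟩ := exists_dotProduct_mulVec_eq_sSup_spectrum (isHermitian_aAlphaMatrix α G)
  have hxx : 0 < x ⬝ᵥ x := by
    have := dotProduct_star_self_pos_iff.2 hx0
    simpa using this
  have hd : ∀ v, (0 : ℝ) < G.degree v := fun v => by exact_mod_cast hpos v
  have hle : x ⬝ᵥ aAlphaMatrix α G *ᵥ x ≤ ∑ v, ∑ w, if G.Adj v w then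
      2 / 3 * x v ^ 2 + 1 / 3 * (x v ^ 2 * (G.degree w / G.degree v)) else 0 := by
    have hswap : ∑ v, ∑ w, (if G.Adj v w then
          (2 / 3 - α) * x v ^ 2 + 1 / 3 * (x v ^ 2 * (G.degree w / G.degree v)) else 0) =
        ∑ v, ∑ w, (if G.Adj v w then
          (2 / 3 - α) * x w ^ 2 + 1 / 3 * (x w ^ 2 * (G.degree v / G.degree w)) else 0) := by
      rw [Finset.sum_comm]
      simp only [G.adj_comm]
    -- Split `1 - α = 1/3 + (2/3 - α)`. The first share uses AM-GM weighted by `d(w)/d(v)`, the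
    -- second the plain `2xy ≤ x² + y²`, which needs `α ≤ 2/3`. Together with the diagonal `α` this
    -- leaves the coefficient `2/3`.
    have hmain : ∑ v, ∑ w, (if G.Adj v w then 2 * ((1 - α) * (x v * x w)) else 0) ≤
        ∑ v, ∑ w, (if G.Adj v w then
          (2 / 3 - α) * x v ^ 2 + 1 / 3 * (x v ^ 2 * (G.degree w / G.degree v)) else 0) +
        ∑ v, ∑ w, (if G.Adj v w then
          (2 / 3 - α) * x w ^ 2 + 1 / 3 * (x w ^ 2 * (G.degree v / G.degree w)) else 0) := by
      simp only [← Finset.sum_add_distrib]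
      refine Finset.sum_le_sum fun v _ => Finset.sum_le_sum fun w _ => ?_
      split_ifs
      · have h1 : 2 * (x v * x w) ≤ x v ^ 2 * (G.degree w / G.degree v) +
            x w ^ 2 * (G.degree v / G.degree w) := by
          have h2 : x v ^ 2 * (G.degree w / G.degree v) + x w ^ 2 * (G.degree v / G.degree w) -
              2 * (x v * x w) = (x v * G.degree w - x w * G.degree v) ^ 2 /
                (G.degree v * G.degree w : ℝ) := by
            have := (hd v).ne'
            have := (hd w).ne'
            field_simp
            ring
          have h3 : 0 ≤ (x v * G.degree w - x w * G.degree v) ^ 2 /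
                (G.degree v * G.degree w : ℝ) := by positivity
          linarith
        nlinarith [mul_nonneg (sub_nonneg.2 hα) (sq_nonneg (x v - x w))]
      · simp
    rw [← hswap] at hmain
    have e1 : ∀ f g : V → V → ℝ, (∑ v, ∑ w, if G.Adj v w then f v w + g v w else 0) =
        (∑ v, ∑ w, if G.Adj v w then f v w else 0) + ∑ v, ∑ w, if G.Adj v w then g v w else 0 := by
      intro f g
      simp only [← Finset.sum_add_distrib]
      refine Finset.sum_congr rfl fun v _ => Finset.sum_congr rfl fun w _ => ?_
      split_ifs <;> simp
    have e2 : ∀ (a : ℝ) (f : V → V → ℝ), (∑ v, ∑ w, if G.Adj v w then a * f v w else 0) =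
        a * ∑ v, ∑ w, if G.Adj v w then f v w else 0 := by
      intro a f
      simp only [Finset.mul_sum, mul_ite, mul_zero]
    rw [dotProduct_aAlphaMatrix_mulVec]
    simp only [e1, e2] at hmain ⊢
    linarith
  have hrow : ∀ v, (∑ w, if G.Adj v w then
      2 / 3 * x v ^ 2 + 1 / 3 * (x v ^ 2 * (G.degree w / G.degree v)) else 0) =
      x v ^ 2 * ((2 * (G.degree v : ℝ) ^ 2 + ∑ w ∈ G.neighborFinset v, (G.degree w : ℝ)) /
        (3 * G.degree v)) := by
    intro v
    have := (hd v).ne'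
    rw [← Finset.sum_filter, ← neighborFinset_eq_filter, Finset.sum_add_distrib, Finset.sum_const,
      card_neighborFinset_eq_degree, ← Finset.mul_sum, ← Finset.mul_sum, ← Finset.sum_div,
      nsmul_eq_mul]
    field_simp
  simp only [hrow] at hle
  have hlt : ∑ v, x v ^ 2 * ((2 * (G.degree v : ℝ) ^ 2 + ∑ w ∈ G.neighborFinset v, (G.degree w : ℝ)) /
        (3 * G.degree v)) < c * (x ⬝ᵥ x) := by
    rw [dotProduct, Finset.mul_sum]
    have hq : ∀ v, (2 * (G.degree v : ℝ) ^ 2 + ∑ w ∈ G.neighborFinset v, (G.degree w : ℝ)) /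
        (3 * G.degree v) < c := fun v => by
      rw [div_lt_iff₀ (by have := hd v; positivity)]
      linarith [h v]
    obtain ⟨i, hi⟩ := Function.ne_iff.1 hx0
    refine Finset.sum_lt_sum (fun v _ => ?_) ⟨i, Finset.mem_univ i, ?_⟩
    · nlinarith [hq v, sq_nonneg (x v)]
    · have : 0 < x i ^ 2 := by
        have : x i ≠ 0 := hi
        positivity
      nlinarith [hq i]
  rw [hx] at hle
  exact lt_of_mul_lt_mul_right (hle.trans_lt hlt) hxx.le

open Classical in
/-- A graph without isolated vertices and with `λ_α ≥ n - 2`, where `α ≤ 2/3`, has at most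
`3(n - 1)/2` non-edges. -/
theorem sum_degrees_of_le_lambdaAlpha {V : Type u} [Fintype V] {α : ℝ} (hα : α ≤ 2 / 3)
    (G : SimpleGraph V) (hpos : ∀ v, 0 < G.degree v) (hn : 4 ≤ Fintype.card V)
    (h : (Fintype.card V : ℝ) - 2 ≤ lambdaAlpha α G) :
    (Fintype.card V - 1) * (Fintype.card V - 3) ≤ ∑ v, G.degree v := by
  have : Nonempty V := Fintype.card_pos_iff.1 (by omega)
  by_contra! hlt
  refine absurd h (not_le.2 (lambdaAlpha_lt_of_forall hα G hpos fun v => ?_))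
  obtain ⟨n, hnV⟩ : ∃ n, n = Fintype.card V := ⟨_, rfl⟩
  rw [← hnV] at hn hlt ⊢
  have hn' : (4 : ℝ) ≤ n := by exact_mod_cast hn
  have hlt' : ∑ w, (G.degree w : ℝ) < (n - 1) * (n - 3) := by
    have : ((∑ w, G.degree w : ℕ) : ℝ) < ((n - 1) * (n - 3) : ℕ) := by exact_mod_cast hlt
    push_cast [show 1 ≤ n by omega, show 3 ≤ n by omega] at this
    exact this
  have hle : ∀ w, (G.degree w : ℝ) ≤ n - 1 := fun w => by
    have := G.degree_lt_card_verts w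
    rw [le_sub_iff_add_le]
    exact_mod_cast (by omega : G.degree w + 1 ≤ n)
  have hS1 : ∑ w ∈ G.neighborFinset v, (G.degree w : ℝ) ≤ G.degree v * (n - 1) := by
    have := Finset.sum_le_card_nsmul (G.neighborFinset v) (fun w => (G.degree w : ℝ)) (n - 1)
      fun w _ => hle w
    simpa using this
  -- The `n - 1` comes from `d(v)` for `v` itself plus at least `1` for each of the `n - 1 - d(v)`
  -- non-neighbours.
  have hS2 : ∑ w ∈ G.neighborFinset v, (G.degree w : ℝ) + (n - 1) ≤ ∑ w, (G.degree w : ℝ) := by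
    have h1 : ∑ w ∈ (G.neighborFinset v), (G.degree w : ℝ) +
        ∑ w ∈ (G.neighborFinset v)ᶜ, (G.degree w : ℝ) = ∑ w, (G.degree w : ℝ) :=
      Finset.sum_add_sum_compl _ _
    have hv : v ∈ (G.neighborFinset v)ᶜ := by simp
    rw [← Finset.add_sum_erase _ _ hv] at h1
    have h2 := Finset.card_nsmul_le_sum ((G.neighborFinset v)ᶜ.erase v)
      (fun w => (G.degree w : ℝ)) 1 fun w _ => by exact_mod_cast hpos w
    have h3 : (((G.neighborFinset v)ᶜ.erase v).card : ℝ) + G.degree v + 1 = n := by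
      have h4 := Finset.card_erase_add_one hv
      have h5 := Finset.card_compl_add_card (G.neighborFinset v)
      rw [card_neighborFinset_eq_degree] at h5
      exact_mod_cast (by omega :
        ((G.neighborFinset v)ᶜ.erase v).card + G.degree v + 1 = n)
    rw [nsmul_eq_mul, mul_one] at h2
    linarith
  have hdv : (1 : ℝ) ≤ G.degree v := by exact_mod_cast hpos v
  -- For small degree `hS1` suffices. Otherwise `hS2` bounds the neighbour sum strictly by `(n -
  -- 1)(n - 4)`, and `(n - 1 - d)(d - (n - 4)) ≥ 0` concludes; this is tight at `d = n - 1`, whence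
  -- the threshold `(n - 1)(n - 3)`.
  by_cases hd : (G.degree v : ℝ) ≤ n - 4
  · nlinarith
  · have h1 := hle v
    push Not at hd
    nlinarith [mul_nonneg (sub_nonneg.2 h1) (sub_nonneg.2 hd.le)]

/-! ### Lower bound for the extremal graph -/

/-- The quadratic form of `A_α(G)` is bounded by `λ_α(G)`. -/
theorem dotProduct_aAlphaMatrix_mulVec_le {V : Type u} [Fintype V] (α : ℝ) (G : SimpleGraph V)
    (x : V → ℝ) : x ⬝ᵥ aAlphaMatrix α G *ᵥ x ≤ lambdaAlpha α G * (x ⬝ᵥ x) := by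
  classical
  exact dotProduct_mulVec_le_sSup_spectrum (isHermitian_aAlphaMatrix α G) x

/-- `λ_α(K₁ ∨ (K_{n-2} ∪ K₁)) ≥ n - 2`, by restriction to the clique on `n - 1` vertices. -/
theorem le_lambdaAlpha_extremalGraph {α : ℝ} (hα : 0 ≤ α) {n : ℕ} (hn : 2 ≤ n) :
    (n : ℝ) - 2 ≤ lambdaAlpha α (extremalGraph n) := by
  obtain ⟨m, rfl⟩ := Nat.exists_eq_add_of_le' hn
  let x : Fin 1 ⊕ (Fin (m + 2 - 2) ⊕ Fin 1) → ℝ := Sum.elim 1 (Sum.elim 1 0)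
  have h := dotProduct_aAlphaMatrix_mulVec_le α (extremalGraph (m + 2)) x
  have hxx : x ⬝ᵥ x = m + 1 := by
    simp [dotProduct, x]
    ring
  -- The extra `α` is the diagonal contribution of the pendant edge at the cut vertex; since `α ≥ 0`
  -- it can be dropped.
  have hform : x ⬝ᵥ aAlphaMatrix α (extremalGraph (m + 2)) *ᵥ x = m * (m + 1) + α := by
    rw [dotProduct_aAlphaMatrix_mulVec]
    simp only [Fintype.sum_sum_type]
    have hrow : ∀ i : Fin m, (1 : ℝ) + (Finset.univ \ {i}).card = m := fun i => by
      have h1 := Finset.card_sdiff_add_card_eq_card (Finset.subset_univ {i})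
      rw [Finset.card_singleton, Finset.card_univ, Fintype.card_fin] at h1
      rw [add_comm]
      exact_mod_cast h1
    simp [extremalGraph, join, x, Finset.sum_ite, Finset.filter_not, Finset.filter_eq, hrow]
    ring
  rw [hxx, hform] at h
  have hm : (0 : ℝ) < m + 1 := by positivity
  push_cast
  nlinarith

end PathFactor

/-- The spectral hypothesis forces a Hamiltonian path. The excluded graph `K₁ ∨ (K_{n-2} ∪ K₁)` has
one as well, so the argument covers it and `hne` is not needed. -/
theorem corollary1p2 {V : Type*} [Fintype V] (G : SimpleGraph V) (n : ℕ) (α : ℝ)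
    (hα₀ : 0 ≤ α) (hα₁ : α < 2 / 3) (hG : G.Connected)
    (hcard : Fintype.card V = n) (hn : 25 ≤ n)
    (hlam : PathFactor.lambdaAlpha α G ≥ PathFactor.lambdaAlpha α (PathFactor.extremalGraph n))
    (hne : ¬ Nonempty (G ≃g PathFactor.extremalGraph n)) :
    PathFactor.HasPathFactorGE 3 G := by
  classical
  have hcard' : 25 ≤ Fintype.card V := by omega
  have : Nontrivial V := Fintype.one_lt_card_iff_nontrivial.1 (by omega)
  have hlow : (Fintype.card V : ℝ) - 2 ≤ PathFactor.lambdaAlpha α G := by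
    rw [hcard]
    exact (PathFactor.le_lambdaAlpha_extremalGraph hα₀ (by omega)).trans hlam
  have hdeg := PathFactor.sum_degrees_of_le_lambdaAlpha hα₁.le G
    (fun v => hG.preconnected.degree_pos_of_nontrivial v) (by omega) hlow
  exact (PathFactor.traceable_of_sum_degrees hG (by omega) hdeg).hasPathFactorGE (by omega)
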